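/- A topological group is called compactly generated if it is algebraically generated by some compact subset. (No separation or local compactness assumption is made on topological groups.) A finite graph of topological groups $(\mathcal G,\Lambda)$ consists of a finite connected graph $\Lambda$ in the sense of Serre (loops and multiple edges are allowed; each oriented edge $e$ has an inverse $\bar e\neq e$ and a terminal vertex $t(e)$), a topological group $\mathcal G_v$ for every vertex $v$, a topological group $\mathcal G_e=\mathcal G_{\bar e}$ for every edge $e$, and an injective, continuous and open homomorphism $\eta_e\colon\mathcal G_e\to\mathcal G_{t(e)}$ for every oriented edge $e$. Let $F(\mathcal G)$ be the group generated by all vertex groups and all oriented edges subject to the relations $\bar e=e^{-1}$ and $e\,\eta_e(c)\,e^{-1}=\eta_{\bar e}(c)$ for $c\in\mathcal G_e$. For a vertex $a$ of $\Lambda$, the fundamental group $\pi_1(\mathcal G,\Lambda,a)$ is the subgroup of $F(\mathcal G)$ consisting of the elements $x_0e_1x_1\cdots e_nx_n$ ($n\ge 0$), where $e_1\cdots e_n$ is a closed edge path at $a$, $x_0\in \mathcal G_a$ and $x_i\in\mathcal G_{t(e_i)}$. It carries its canonical topology, that is, the unique group topology for which the canonical monomorphisms $\mathcal G_v\to\pi_1(\mathcal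 G,\Lambda,a)$ (defined up to conjugation) are open topological embeddings; explicitly, the finest topology for which all maps $\mathcal G_v\to\pi_1(\mathcal G,\Lambda,a)$, $x\mapsto p\,x\,q$, are continuous, where $p$ and $q$ are elements of $F(\mathcal G)$ that come in the same way from edge paths from $a$ to $v$ and from $v$ to $a$, respectively. Theorem. (1) Let $(\mathcal G,\Lambda)$ be a finite graph of topological groups such that all edge groups are compactly generated, and let $a$ be a vertex of $\Lambda$. If $\pi_1(\mathcal G,\Lambda,a)$ is compactly generated, then all vertex groups $\mathcal G_v$ are compactly generated. (2) Let $G$ be a topological group acting by automorphisms on a tree $T$ such that the action is discrete (pointwise stabilizers of vertices and of edges are open subgroups of $G$), cocompact (the $G$-translates of some finite subgraph cover $T$) and without inversions (an element that stabilizes an edge fixes its end points), and such that all edge stabilizers are compactly generated. If $G$ is compactly generated, then all vertex stabilizers are compactly generated. -/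

import Mathlib

/-- A topological group is compactly generated if it admits a compact generating set. -/
def IsCompactlyGeneratedGroup (G : Type*) [Group G] [TopologicalSpace G] : Prop :=
  ∃ S : Set G, IsCompact S ∧ Subgroup.closure S = ⊤

/-- A graph of topological groups over a connected graph.

The underlying graph, in the sense of Serre, has vertex set `V` and set of oriented edges
`K × Bool`: an unoriented edge `k : K` carries the two oriented edges `(k, true)` and
`(k, false)`, which are inverse to each other. (Every graph of Serre is of this form, after
choosing an orientation.) Thus the edge groups of an oriented edge and of its inverse are the
same group `Ge k`. -/
structure GraphOfTopGroups (V K : Type*) (Gv : V → Type*) (Ge : K → Type*)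
    [∀ v, Group (Gv v)] [∀ v, TopologicalSpace (Gv v)]
    [∀ k, Group (Ge k)] [∀ k, TopologicalSpace (Ge k)] where
  /-- the terminal vertex of an oriented edge -/
  term : K × Bool → V
  /-- the graph is connected: it is nonempty and any two vertices are joined by an edge path -/
  nonempty : Nonempty V
  connected : ∀ v w : V,
    Relation.ReflTransGen (fun x y => ∃ e : K × Bool, term (e.1, !e.2) = x ∧ term e = y) v w
  /-- the monomorphism from the edge group to the group of the terminal vertex -/
  η : ∀ e : K × Bool, Ge e.1 →* Gv (term e)
  η_injective : ∀ e, Function.Injective (η e)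
  η_continuous : ∀ e, Continuous (η e)
  η_isOpenMap : ∀ e, IsOpenMap (η e)

namespace GraphOfTopGroups

/-- The inverse of an oriented edge. -/
def rev {K : Type*} (e : K × Bool) : K × Bool := (e.1, !e.2)

section

variable {V K : Type*} {Gv : V → Type*} {Ge : K → Type*}
  [∀ v, Group (Gv v)] [∀ v, TopologicalSpace (Gv v)]
  [∀ k, Group (Ge k)] [∀ k, TopologicalSpace (Ge k)]
  (𝒢 : GraphOfTopGroups V K Gv Ge)

/-- The initial vertex of an oriented edge. -/
def orig (e : K × Bool) : V := 𝒢.term (rev e)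

/-- The free product of all vertex groups and of the free group on the oriented edges. -/
abbrev FreePathGroup (_ : GraphOfTopGroups V K Gv Ge) : Type _ :=
  Monoid.Coprod (Monoid.CoprodI Gv) (FreeGroup (K × Bool))

/-- The inclusion of a vertex group in the free product. -/
def freeVertex (v : V) : Gv v →* 𝒢.FreePathGroup :=
  Monoid.Coprod.inl.comp Monoid.CoprodI.of

/-- The letter of an oriented edge in the free product. -/
def freeEdge (e : K × Bool) : 𝒢.FreePathGroup := Monoid.Coprod.inr (FreeGroup.of e)

/-- The relators of the path group: `e * ē` and `e * η_e(c) * e⁻¹ * η_ē(c)⁻¹`. -/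
def relators : Set 𝒢.FreePathGroup :=
  {r | ∃ e : K × Bool, r = 𝒢.freeEdge e * 𝒢.freeEdge (rev e)} ∪
  {r | ∃ (e : K × Bool) (c : Ge e.1),
    r = 𝒢.freeEdge e * 𝒢.freeVertex (𝒢.term e) (𝒢.η e c) * (𝒢.freeEdge e)⁻¹ *
      (𝒢.freeVertex (𝒢.term (rev e)) (𝒢.η (rev e) c))⁻¹}

/-- The path group: the group generated by the vertex groups and the oriented edges, subject to
the relations `ē = e⁻¹` and `e * η_e(c) * e⁻¹ = η_ē(c)`. -/
abbrev PathGroup : Type _ := 𝒢.FreePathGroup ⧸ Subgroup.normalClosure 𝒢.relators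

/-- The canonical homomorphism from a vertex group to the path group. -/
def vertex (v : V) : Gv v →* 𝒢.PathGroup :=
  (QuotientGroup.mk' (Subgroup.normalClosure 𝒢.relators)).comp (𝒢.freeVertex v)

/-- The element of the path group given by an oriented edge. -/
def edge (e : K × Bool) : 𝒢.PathGroup :=
  QuotientGroup.mk' (Subgroup.normalClosure 𝒢.relators) (𝒢.freeEdge e)

/-- `𝒢.IsPath u w g` says that `g = x₀ * e₁ * x₁ * ⋯ * eₙ * xₙ` in the path group, for an edge
path `e₁, …, eₙ` (with `n ≥ 0`) from `u` to `w` and elements `x₀, …, xₙ` of the groups of the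
successive vertices of this path. -/
inductive IsPath (u : V) : V → 𝒢.PathGroup → Prop
  | nil (x : Gv u) : IsPath u u (𝒢.vertex u x)
  | snoc (e : K × Bool) (g : 𝒢.PathGroup) (x : Gv (𝒢.term e)) :
      IsPath u (𝒢.orig e) g → IsPath u (𝒢.term e) (g * 𝒢.edge e * 𝒢.vertex (𝒢.term e) x)

variable {𝒢}

theorem edge_mul_edge_rev (e : K × Bool) : 𝒢.edge e * 𝒢.edge (rev e) = 1 :=
  (QuotientGroup.eq_one_iff _).2 (Subgroup.subset_normalClosure (Or.inl ⟨e, rfl⟩))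

theorem IsPath.mul_vertex {u w : V} {g : 𝒢.PathGroup} (h : 𝒢.IsPath u w g) (x : Gv w) :
    𝒢.IsPath u w (g * 𝒢.vertex w x) := by
  cases h with
  | nil y => rw [← map_mul]; exact .nil _
  | snoc e g y hg => rw [mul_assoc, ← map_mul]; exact .snoc e g _ hg

theorem IsPath.mul {u v w : V} {g h : 𝒢.PathGroup} (hg : 𝒢.IsPath u v g)
    (hh : 𝒢.IsPath v w h) : 𝒢.IsPath u w (g * h) := by
  induction hh with
  | nil x => exact hg.mul_vertex x
  | snoc e k x _ ih => rw [← mul_assoc, ← mul_assoc]; exact .snoc e _ x ih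

theorem IsPath.edge (e : K × Bool) : 𝒢.IsPath (𝒢.orig e) (𝒢.term e) (𝒢.edge e) := by
  simpa using IsPath.snoc (𝒢 := 𝒢) e _ 1 (.nil 1)

theorem IsPath.edge_inv (e : K × Bool) :
    𝒢.IsPath (𝒢.term e) (𝒢.orig e) (𝒢.edge e)⁻¹ := by
  rw [inv_eq_of_mul_eq_one_right (edge_mul_edge_rev e)]
  obtain ⟨k, b⟩ := e
  cases b
  · exact IsPath.edge (𝒢 := 𝒢) (k, true)
  · exact IsPath.edge (𝒢 := 𝒢) (k, false)

theorem IsPath.inv {u w : V} {g : 𝒢.PathGroup} (h : 𝒢.IsPath u w g) :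
    𝒢.IsPath w u g⁻¹ := by
  induction h with
  | nil x => rw [← map_inv]; exact .nil _
  | snoc e k x _ ih =>
    rw [mul_inv_rev, mul_inv_rev, ← map_inv]
    exact (IsPath.nil _).mul ((IsPath.edge_inv e).mul ih)

theorem IsPath.one (u : V) : 𝒢.IsPath u u 1 := by
  simpa using IsPath.nil (𝒢 := 𝒢) (u := u) 1

variable (𝒢)

/-- The elements of the path group that come from closed paths at the vertex `a`. -/
def loopSubgroup (a : V) : Subgroup 𝒢.PathGroup where
  carrier := {g | 𝒢.IsPath a a g}
  mul_mem' := IsPath.mul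
  one_mem' := IsPath.one a
  inv_mem' := IsPath.inv

/-- The fundamental group of the graph of groups at the base vertex `a`. -/
def FundamentalGroup (a : V) : Type _ := 𝒢.loopSubgroup a

instance (a : V) : Group (𝒢.FundamentalGroup a) :=
  inferInstanceAs (Group (𝒢.loopSubgroup a))

variable {𝒢}

/-- The element of the fundamental group given by a closed path. -/
def ofPath {a : V} {g : 𝒢.PathGroup} (hg : 𝒢.IsPath a a g) : 𝒢.FundamentalGroup a := ⟨g, hg⟩

/-- For paths `p` from `a` to `v` and `q` from `v` to `a`, the map `x ↦ p * x * q` from the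
group of `v` to the fundamental group at `a`. -/
def loop {a v : V} {p q : 𝒢.PathGroup} (hp : 𝒢.IsPath a v p) (hq : 𝒢.IsPath v a q)
    (x : Gv v) : 𝒢.FundamentalGroup a :=
  ofPath ((hp.mul_vertex x).mul hq)

variable (𝒢)

/-- The canonical topology of the fundamental group: the finest topology for which all maps
`x ↦ p * x * q` from the vertex groups are continuous. It is the only group topology for which
the canonical maps `x ↦ p * x * p⁻¹` from the vertex groups are open embeddings, see
`eq_canonicalTopology`. -/
instance canonicalTopology (a : V) : TopologicalSpace (𝒢.FundamentalGroup a) where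
  IsOpen U := ∀ (v : V) (p q : 𝒢.PathGroup) (hp : 𝒢.IsPath a v p) (hq : 𝒢.IsPath v a q),
    IsOpen (loop hp hq ⁻¹' U)
  isOpen_univ := fun _ _ _ _ _ => isOpen_univ
  isOpen_inter := fun _ _ hs ht v p q hp hq => (hs v p q hp hq).inter (ht v p q hp hq)
  isOpen_sUnion := fun S hS v p q hp hq => by
    rw [Set.preimage_sUnion]
    exact isOpen_biUnion fun s hs => hS s hs v p q hp hq

/-- A group topology on the fundamental group for which, at each vertex `v`, some canonical map
`x ↦ p * x * p⁻¹` from the vertex group is an open embedding, is the canonical topology. -/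
theorem eq_canonicalTopology (a : V) (τ : TopologicalSpace (𝒢.FundamentalGroup a))
    (hτ : @IsTopologicalGroup _ τ _)
    (h : ∀ v, ∃ (p : 𝒢.PathGroup) (hp : 𝒢.IsPath a v p),
      @Topology.IsOpenEmbedding _ _ _ τ (loop hp hp.inv)) :
    τ = 𝒢.canonicalTopology a := by
  refine TopologicalSpace.ext (funext fun U => propext ⟨fun hU v p q hp hq => ?_, fun hU => ?_⟩)
  · obtain ⟨p₀, hp₀, he⟩ := h v
    have hc : @Continuous _ _ _ τ fun x =>
        ofPath (hp.mul hp₀.inv) * loop hp₀ hp₀.inv x *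
          ofPath (hp₀.mul hq) :=
      (continuous_const.mul he.continuous).mul continuous_const
    have heq : loop hp hq = fun x =>
        ofPath (hp.mul hp₀.inv) * loop hp₀ hp₀.inv x *
          ofPath (hp₀.mul hq) := by
      funext x
      apply Subtype.ext
      change p * 𝒢.vertex v x * q = p * p₀⁻¹ * (p₀ * 𝒢.vertex v x * p₀⁻¹) * (p₀ * q)
      group
    rw [heq]
    exact hU.preimage hc
  · obtain ⟨p₀, hp₀, he⟩ := h a
    rw [@isOpen_iff_mem_nhds]
    intro g hg
    have ho := he.isOpenMap _ (hU a (g.1 * p₀) p₀⁻¹ (IsPath.mul g.2 hp₀) hp₀.inv)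
    have ho' := (@Homeomorph.mulLeft _ τ _ _ g).isOpenMap _ ho
    refine Filter.mem_of_superset (ho'.mem_nhds ?_) ?_
    · refine ⟨1, ⟨1, ?_, ?_⟩, mul_one g⟩
      · have : loop (𝒢 := 𝒢) (IsPath.mul g.2 hp₀) hp₀.inv 1 = g := by
          apply Subtype.ext
          change g.1 * p₀ * 𝒢.vertex a 1 * p₀⁻¹ = g.1
          simp
        rw [Set.mem_preimage, this]
        exact hg
      · apply Subtype.ext
        change p₀ * 𝒢.vertex a 1 * p₀⁻¹ = 1
        simp
    · rintro _ ⟨_, ⟨x, hx, rfl⟩, rfl⟩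
      have : g * loop hp₀ hp₀.inv x = loop (𝒢 := 𝒢) (IsPath.mul g.2 hp₀) hp₀.inv x := by
        apply Subtype.ext
        change g.1 * (p₀ * 𝒢.vertex a x * p₀⁻¹) = g.1 * p₀ * 𝒢.vertex a x * p₀⁻¹
        group
      change g * loop hp₀ hp₀.inv x ∈ U
      rw [this]
      exact hx

end

end GraphOfTopGroups

/-- The action of `G` on the vertices of the graph `T` is an action on `T` by automorphisms. -/
def ActsOnGraph (G : Type*) {X : Type*} [Group G] [MulAction G X] (T : SimpleGraph X) : Prop :=
  ∀ (g : G) (x y : X), T.Adj x y → T.Adj (g • x) (g • y)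

/-- The pointwise stabilizer of the edge with end points `x` and `y`. For an action without
inversions it is also the setwise stabilizer. -/
def edgeStabilizer (G : Type*) {X : Type*} [Group G] [MulAction G X] (x y : X) : Subgroup G :=
  MulAction.stabilizer G x ⊓ MulAction.stabilizer G y

/-- The action is discrete: the pointwise stabilizers of all cells are open. -/
def ActsDiscretely (G : Type*) {X : Type*} [Group G] [TopologicalSpace G] [MulAction G X]
    (T : SimpleGraph X) : Prop :=
  (∀ x : X, IsOpen (MulAction.stabilizer G x : Set G)) ∧
    ∀ x y : X, T.Adj x y → IsOpen (edgeStabilizer G x y : Set G)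

/-- The action is cocompact: the translates of some finite subgraph cover the graph. -/
def ActsCocompactly (G : Type*) {X : Type*} [Group G] [MulAction G X]
    (T : SimpleGraph X) : Prop :=
  ∃ H : T.Subgraph, H.verts.Finite ∧
    (∀ x : X, ∃ g : G, ∃ x' ∈ H.verts, g • x' = x) ∧
    ∀ x y : X, T.Adj x y → ∃ (g : G) (x' y' : X), H.Adj x' y' ∧ g • x' = x ∧ g • y' = y

/-- The action is without inversions: an element that stabilizes an edge fixes its end points. -/
def ActsWithoutInversions (G : Type*) {X : Type*} [Group G] [MulAction G X]
    (T : SimpleGraph X) : Prop :=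
  ∀ (g : G) (x y : X), T.Adj x y → s(g • x, g • y) = s(x, y) → g • x = x ∧ g • y = y

/-! Both parts rest on one remark: a compactly generated group that is a directed union of open
subgroups equals one of them. The vertex groups are approximated by families H of compactly
generated subgroups that absorb what comes from the edge groups. Such families are directed, and
each determines an open subgroup P(H) of the big group. Every element lies in some P(H), since it
requires only finitely many additional generators. So some P(H) is everything, and it remains to see
that H is then the whole vertex group.

For a graph of groups, P(H) consists of the loops in the subgroup generated by the edges and the
groups `H v`. That this subgroup meets `Gv v` only in `H v` would follow from normal forms; here it
follows from a permutation representation (`exists_hom_perm`) on a set with two halves: edges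
preserve the halves, and an element of `Gv v` does so if and only if it is in `H v`.

For an action on a tree, the cosets of the groups in H form a graph over the tree, and P(H) is the
stabilizer of a component. H contains enough of the edge stabilizers for the projection to be
locally injective, hence injective on components, as a tree has no cycles. If P(H) is everything, a
vertex stabilizer moves a point of the component inside its fibre, thus fixes it, and so lies in the
corresponding conjugate of a group of H. -/

open scoped Pointwise
open Topology

universe u w

/-! ### Compactly generated subgroups and directed unions -/

/-- The subgroup generated by `D` is generated by a compact set. -/
def CompactlySpanned {G : Type*} [Group G] [TopologicalSpace G] (D : Set G) : Prop :=
  ∃ S : Set G, IsCompact S ∧ Subgroup.closure S = Subgroup.closure D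

namespace CompactlySpanned

variable {G : Type*} [Group G] [TopologicalSpace G]

theorem of_isCompact {D : Set G} (h : IsCompact D) : CompactlySpanned D := ⟨D, h, rfl⟩

theorem iUnion {ι : Type*} [Finite ι] {D : ι → Set G} (h : ∀ i, CompactlySpanned (D i)) :
    CompactlySpanned (⋃ i, D i) := by
  choose S hS hD using h
  exact ⟨⋃ i, S i, isCompact_iUnion hS, by simp only [Subgroup.closure_iUnion, hD]⟩

theorem union {D E : Set G} (hD : CompactlySpanned D) (hE : CompactlySpanned E) :
    CompactlySpanned (D ∪ E) := by
  obtain ⟨S, hS, hSD⟩ := hD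
  obtain ⟨S', hS', hSE⟩ := hE
  exact ⟨S ∪ S', hS.union hS', by simp only [Subgroup.closure_union, hSD, hSE]⟩

theorem sup {H K : Subgroup G} (hH : CompactlySpanned (H : Set G))
    (hK : CompactlySpanned (K : Set G)) : CompactlySpanned ((H ⊔ K : Subgroup G) : Set G) := by
  obtain ⟨S, hS, h⟩ := hH.union hK
  exact ⟨S, hS, by rw [h, Subgroup.closure_union, Subgroup.closure_eq, Subgroup.closure_eq,
    Subgroup.closure_eq]⟩

theorem closure {D : Set G} (h : CompactlySpanned D) :
    CompactlySpanned (Subgroup.closure D : Set G) := by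
  obtain ⟨S, hS, h⟩ := h
  exact ⟨S, hS, by rw [h, Subgroup.closure_eq]⟩

theorem map {G' : Type*} [Group G'] [TopologicalSpace G'] {D : Set G} (h : CompactlySpanned D)
    (f : G →* G') (hf : Continuous f) : CompactlySpanned (f '' D) := by
  obtain ⟨S, hS, h⟩ := h
  exact ⟨f '' S, hS.image hf, by rw [← MonoidHom.map_closure, h, MonoidHom.map_closure]⟩

/-- A coset `a • K` contains `a`, hence generates the same subgroup as `K` and `a` together. -/
theorem smul {K : Subgroup G} (h : CompactlySpanned (K : Set G)) (a : G) :
    CompactlySpanned (a • (K : Set G)) := by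
  obtain ⟨S, hS, h⟩ := h
  rw [Subgroup.closure_eq] at h
  refine ⟨insert a S, hS.insert a, le_antisymm ?_ ?_⟩
  · have ha : a ∈ Subgroup.closure (a • (K : Set G)) :=
      Subgroup.subset_closure ⟨1, K.one_mem, mul_one a⟩
    rw [Subgroup.closure_le, Set.insert_subset_iff]
    refine ⟨ha, fun s hs => ?_⟩
    have hs' : a • s ∈ Subgroup.closure (a • (K : Set G)) :=
      Subgroup.subset_closure (Set.smul_mem_smul_set (h ▸ Subgroup.subset_closure hs))
    simpa using mul_mem (inv_mem ha) hs'
  · rw [Subgroup.closure_le]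
    rintro _ ⟨k, hk, rfl⟩
    refine mul_mem (Subgroup.subset_closure (Set.mem_insert _ _)) ?_
    exact Subgroup.closure_mono (Set.subset_insert _ _) (h ▸ hk)

end CompactlySpanned

theorem IsCompactlyGeneratedGroup.compactlySpanned_image {G G' : Type*} [Group G]
    [TopologicalSpace G] [Group G'] [TopologicalSpace G'] (h : IsCompactlyGeneratedGroup G)
    (f : G →* G') (hf : Continuous f) : CompactlySpanned (f.range : Set G') := by
  obtain ⟨S, hS, h⟩ := h
  exact ⟨f '' S, hS.image hf, by
    rw [← MonoidHom.map_closure, h, ← MonoidHom.range_eq_map, Subgroup.closure_eq]⟩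

theorem CompactlySpanned.isCompactlyGeneratedGroup {G : Type*} [Group G] [TopologicalSpace G]
    {H : Subgroup G} (h : CompactlySpanned (H : Set G)) : IsCompactlyGeneratedGroup H := by
  obtain ⟨S, hS, h⟩ := h
  rw [Subgroup.closure_eq] at h
  have hSH : S ⊆ H := h ▸ Subgroup.subset_closure
  have him : (Subtype.val : H → G) '' (Subtype.val ⁻¹' S) = S :=
    Set.image_preimage_eq_of_subset fun s hs => ⟨⟨s, hSH hs⟩, rfl⟩
  refine ⟨Subtype.val ⁻¹' S, ?_, ?_⟩
  · exact Topology.IsInducing.subtypeVal.isCompact_iff.2 (him.symm ▸ hS)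
  · apply Subgroup.map_injective H.subtype_injective
    rw [MonoidHom.map_closure, ← MonoidHom.range_eq_map, Subgroup.range_subtype]
    exact (congrArg Subgroup.closure him).trans h

/-- If a compactly generated group is the directed union of open subgroups, then it is one of
them. -/
theorem IsCompactlyGeneratedGroup.eq_top_of_directed {G : Type*} [Group G] [TopologicalSpace G]
    (hG : IsCompactlyGeneratedGroup G) {ι : Type*} [Nonempty ι] (P : ι → Subgroup G)
    (ho : ∀ i, IsOpen (P i : Set G)) (hP : Directed (· ≤ ·) P) (hc : ∀ g, ∃ i, g ∈ P i) :
    ∃ i, P i = ⊤ := by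
  obtain ⟨S, hS, h⟩ := hG
  obtain ⟨i, hi⟩ := hS.elim_directed_cover (fun i => (P i : Set G)) ho
    (fun g _ => Set.mem_iUnion.2 (hc g)) hP
  exact ⟨i, top_le_iff.1 (h ▸ (Subgroup.closure_le _).2 hi)⟩

/-! ### Locally injective maps to acyclic graphs -/

namespace SimpleGraph

/-- A locally injective homomorphism to an acyclic graph maps paths to paths. -/
theorem IsAcyclic.isPath_map_of_locally_injective {α X : Type*} {T' : SimpleGraph α}
    {T : SimpleGraph X} (hT : T.IsAcyclic) (f : T' →g T)
    (hf : ∀ a b c, T'.Adj a b → T'.Adj a c → f b = f c → b = c) {a b : α} (p : T'.Walk a b)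
    (hp : p.IsPath) : (p.map f).IsPath := by
  -- In an acyclic graph a walk is a path once it does not backtrack, and this is a local condition.
  rw [hT.isPath_iff_isChain]
  induction p with
  | nil => simp
  | cons h p ih =>
    cases p with
    | nil => simp
    | cons h' p =>
      have ih' := ih hp.of_cons
      simp only [Walk.map_cons, Walk.edges_cons, List.isChain_cons_cons] at ih' ⊢
      refine ⟨fun he => ?_, ih'⟩
      rw [Sym2.eq_iff] at he
      rcases he with ⟨h1, -⟩ | ⟨h1, -⟩
      · exact (f.map_adj h).ne h1
      · have := hf _ _ _ h.symm h' h1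
        subst this
        rw [Walk.cons_isPath_iff] at hp
        exact hp.2 (by simp)

/-- A locally injective homomorphism to an acyclic graph is injective on connected components. -/
theorem IsAcyclic.eq_of_reachable_of_locally_injective {α X : Type*} {T' : SimpleGraph α}
    {T : SimpleGraph X} (hT : T.IsAcyclic) (f : T' →g T)
    (hf : ∀ a b c, T'.Adj a b → T'.Adj a c → f b = f c → b = c) {a b : α}
    (h : T'.Reachable a b) (hab : f a = f b) : a = b := by
  obtain ⟨p, hp⟩ := h.exists_isPath
  have := hT.isPath_map_of_locally_injective f hf p hp
  cases p with
  | nil => rfl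
  | cons h' p =>
    rw [Walk.map_cons, Walk.cons_isPath_iff] at this
    exact this.2 (by rw [hab]; exact Walk.end_mem_support _) |>.elim

end SimpleGraph

/-! ### Actions on trees and the graph of cosets -/

namespace ActsOnGraph

section

variable (G : Type*) {X : Type*} [Group G] [MulAction G X]

/-- A chosen representative of the orbit of a point. -/
noncomputable def orbitRep (x : X) : X := (Quotient.mk (MulAction.orbitRel G X) x).out

theorem orbitRep_smul (g : G) (x : X) : orbitRep G (g • x) = orbitRep G x :=
  congrArg Quotient.out (Quotient.sound (s := MulAction.orbitRel G X) ⟨g, rfl⟩)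

theorem exists_smul_orbitRep (x : X) : ∃ g : G, g • orbitRep G x = x :=
  MulAction.orbitRel_apply.1
    ((MulAction.orbitRel G X).symm (Quotient.mk_out (s := MulAction.orbitRel G X) x))

/-- A chosen element that carries the representative of the orbit of a point to this point. -/
noncomputable def transporter (x : X) : G := (exists_smul_orbitRep G x).choose

theorem transporter_smul (x : X) : transporter G x • orbitRep G x = x :=
  (exists_smul_orbitRep G x).choose_spec

variable {G}

theorem orbitRep_eq {g g' : G} {x y : X} (h : g • x = g' • y) : orbitRep G x = orbitRep G y := by
  rw [← orbitRep_smul G g, h, orbitRep_smul]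

/-- The translate by `g` of the vertex above `x` in the graph of cosets. -/
noncomputable def cosetVertex (H : X → Subgroup G) (g : G) (x : X) : X × Set G :=
  (g • x, (g * transporter G x) • (H (orbitRep G x) : Set G))

theorem smul_cosetVertex (H : X → Subgroup G) (h g : G) (x : X) :
    h • cosetVertex H g x = cosetVertex H (h * g) x := by
  simp only [cosetVertex, Prod.smul_mk, smul_smul, mul_assoc]

theorem cosetVertex_eq_iff (H : X → Subgroup G) {g g' : G} {x y : X} (h : g • x = g' • y) :
    cosetVertex H g x = cosetVertex H g' y ↔
      (g * transporter G x)⁻¹ * (g' * transporter G y) ∈ H (orbitRep G x) := by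
  rw [← leftCoset_eq_iff, cosetVertex, cosetVertex, Prod.mk.injEq, orbitRep_eq h]
  simp [h]

variable {T : SimpleGraph X} (F : T.Subgraph)

/-- The graph of cosets: its vertices lie above the vertices of `T`, its edges are the translates
of the edges of a subgraph `F`. -/
def cosetGraph (H : X → Subgroup G) : SimpleGraph (X × Set G) where
  Adj a b := ∃ (g : G) (y z : X), F.Adj y z ∧ a = cosetVertex H g y ∧ b = cosetVertex H g z
  symm := ⟨fun _ _ ⟨g, y, z, h, ha, hb⟩ => ⟨g, z, y, h.symm, hb, ha⟩⟩
  loopless := ⟨fun _ ⟨g, _, _, h, ha, hb⟩ =>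
    h.ne (smul_left_cancel g (congrArg Prod.fst (ha.symm.trans hb)))⟩

theorem reachable_smul {H : X → Subgroup G} {a b : X × Set G}
    (h : (cosetGraph F H).Reachable a b) (k : G) :
    (cosetGraph F H).Reachable (k • a) (k • b) := by
  refine h.map (⟨fun p => k • p, ?_⟩ : cosetGraph F H →g cosetGraph F H)
  rintro _ _ ⟨g, y, z, h, rfl, rfl⟩
  exact ⟨k * g, y, z, h, smul_cosetVertex .., smul_cosetVertex ..⟩

/-- Enlarging each coset of `H` to the coset of `H'` that contains it is a map of graphs. -/
theorem reachable_mono {H H' : X → Subgroup G} (hH : H ≤ H') {g g' : G} {x y : X}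
    (h : (cosetGraph F H).Reachable (cosetVertex H g x) (cosetVertex H g' y)) :
    (cosetGraph F H').Reachable (cosetVertex H' g x) (cosetVertex H' g' y) := by
  let π : X × Set G → X × Set G := fun p => (p.1, p.2 * (H' (orbitRep G p.1) : Set G))
  have hπ : ∀ g x, π (cosetVertex H g x) = cosetVertex H' g x := fun g x => by
    simp only [π, cosetVertex, orbitRep_smul, smul_mul_assoc, Prod.mk.injEq, true_and]
    congr 1
    refine subset_antisymm ?_ fun k hk => ⟨1, one_mem _, k, hk, one_mul k⟩
    rintro _ ⟨h, hh, k, hk, rfl⟩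
    exact mul_mem (hH _ hh) hk
  have := h.map (⟨π, by
    rintro _ _ ⟨g, y, z, h, rfl, rfl⟩
    exact ⟨g, y, z, h, hπ .., hπ ..⟩⟩ : cosetGraph F H →g cosetGraph F H')
  change (cosetGraph F H').Reachable (π _) (π _) at this
  rwa [hπ, hπ] at this

/-- The set-stabilizer of the component of a vertex of the graph of cosets. -/
def componentStabilizer (H : X → Subgroup G) (x : X) : Subgroup G where
  carrier := {g | (cosetGraph F H).Reachable (cosetVertex H 1 x) (cosetVertex H g x)}
  one_mem' := SimpleGraph.Reachable.refl _
  mul_mem' {g h} hg hh := by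
    have := reachable_smul F hh g
    rw [smul_cosetVertex, smul_cosetVertex, mul_one] at this
    exact SimpleGraph.Reachable.trans hg this
  inv_mem' {g} hg := by
    have := reachable_smul F hg g⁻¹
    rw [smul_cosetVertex, smul_cosetVertex, mul_one, inv_mul_cancel] at this
    exact this.symm

/-- The elements by which the vertices above `p.1.2` and `p.2.2` differ if the edges `p.1` and
`p.2` are in the same orbit. -/
def edgeTransporters (p : (X × X) × (X × X)) : Set G :=
  {k | ∃ m : G, m • p.2.1 = p.1.1 ∧ m • p.2.2 = p.1.2 ∧
    k = (transporter G p.1.2)⁻¹ * m * transporter G p.2.2}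

/-- Vertex groups that are compactly generated and contain the necessary elements for the graph
of cosets to be locally embedded in `T`. -/
structure IsAdmissible [TopologicalSpace G] (H : X → Subgroup G) : Prop where
  spanned : ∀ x, CompactlySpanned (H x : Set G)
  le_stabilizer : ∀ x, H x ≤ MulAction.stabilizer G x
  mem : ∀ y z y' z', F.Adj y z → F.Adj y' z' →
    edgeTransporters ((y, z), (y', z')) ⊆ (H (orbitRep G z) : Set G)

end

section

variable {G X : Type*} [Group G] [MulAction G X] [TopologicalSpace G]
  {T : SimpleGraph X} (F : T.Subgraph)

omit [TopologicalSpace G] in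
theorem edgeTransporters_subset_stabilizer (y z y' z' : X) :
    edgeTransporters ((y, z), (y', z')) ⊆ (MulAction.stabilizer G (orbitRep G z) : Set G) := by
  rintro _ ⟨m, -, hz, rfl⟩
  dsimp only at hz ⊢
  have hr : orbitRep G z = orbitRep G z' := by rw [← hz, orbitRep_smul]
  rw [SetLike.mem_coe, MulAction.mem_stabilizer_iff, mul_smul, mul_smul, hr, transporter_smul, hz,
    inv_smul_eq_iff, ← hr, transporter_smul]

/-- If nonempty, this set is a left coset of a conjugate of the stabilizer of the second edge. -/
theorem compactlySpanned_edgeTransporters [IsTopologicalGroup G] (y z y' z' : X)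
    (h : IsCompactlyGeneratedGroup (edgeStabilizer G y' z')) :
    CompactlySpanned (edgeTransporters (G := G) ((y, z), (y', z'))) := by
  by_cases hm : ∃ m : G, m • y' = y ∧ m • z' = z
  · obtain ⟨m, hy, hz⟩ := hm
    have hc := (h.compactlySpanned_image ((MulAut.conj (transporter G z')⁻¹).toMonoidHom.comp
      (Subgroup.subtype _)) (by
        change Continuous fun x : edgeStabilizer G y' z' =>
          (transporter G z')⁻¹ * (x : G) * (transporter G z')⁻¹⁻¹
        fun_prop)).smul ((transporter G z)⁻¹ * m * transporter G z')
    convert hc using 1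
    ext k
    constructor
    · rintro ⟨m', hy', hz', rfl⟩
      refine ⟨_, ⟨⟨m⁻¹ * m', ?_⟩, rfl⟩, ?_⟩
      · refine Subgroup.mem_inf.2 ⟨?_, ?_⟩ <;>
          rw [MulAction.mem_stabilizer_iff, mul_smul, inv_smul_eq_iff]
        · exact hy'.trans hy.symm
        · exact hz'.trans hz.symm
      · simp [mul_assoc]
    · rintro ⟨_, ⟨⟨s, hs⟩, rfl⟩, rfl⟩
      obtain ⟨h1, h2⟩ := Subgroup.mem_inf.1 hs
      rw [MulAction.mem_stabilizer_iff] at h1 h2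
      refine ⟨m * s, ?_, ?_, ?_⟩
      · rw [mul_smul]; exact (congrArg (m • ·) h1).trans hy
      · rw [mul_smul]; exact (congrArg (m • ·) h2).trans hz
      · simp [mul_assoc]
  · convert CompactlySpanned.of_isCompact (isCompact_empty (X := G))
    exact Set.eq_empty_of_forall_notMem fun _ ⟨m, h1, h2, _⟩ => hm ⟨m, h1, h2⟩

/-- As `F` is finite, each group is generated by finitely many of the sets `edgeTransporters`. -/
theorem exists_isAdmissible [IsTopologicalGroup G] (hF : F.verts.Finite)
    (hE : ∀ x y, T.Adj x y → IsCompactlyGeneratedGroup (edgeStabilizer G x y)) :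
    ∃ H : X → Subgroup G, IsAdmissible F H := by
  have := hF.to_subtype
  let ι : X → Type _ := fun x => {p : (F.verts × F.verts) × (F.verts × F.verts) //
    F.Adj p.1.1 p.1.2 ∧ F.Adj p.2.1 p.2.2 ∧ orbitRep G (p.1.2 : X) = x}
  let D : X → Set G := fun x => ⋃ p : ι x,
    edgeTransporters (((p.1.1.1 : X), (p.1.1.2 : X)), ((p.1.2.1 : X), (p.1.2.2 : X)))
  refine ⟨fun x => Subgroup.closure (D x), fun x => ?_, fun x => ?_, ?_⟩
  · exact (CompactlySpanned.iUnion fun p => compactlySpanned_edgeTransporters _ _ _ _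
      (hE _ _ p.2.2.1.adj_sub)).closure
  · refine (Subgroup.closure_le _).2 (Set.iUnion_subset fun p => ?_)
    have := edgeTransporters_subset_stabilizer (G := G) (p.1.1.1 : X) p.1.1.2 p.1.2.1 p.1.2.2
    rwa [p.2.2.2] at this
  · intro y z y' z' h h' k hk
    exact Subgroup.subset_closure (Set.mem_iUnion.2 ⟨⟨((⟨y, F.edge_vert h⟩,
      ⟨z, F.edge_vert h.symm⟩), (⟨y', F.edge_vert h'⟩, ⟨z', F.edge_vert h'.symm⟩)), h, h', rfl⟩, hk⟩)

variable {F}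

theorem IsAdmissible.sup {H H' : X → Subgroup G} (h : IsAdmissible F H) (h' : IsAdmissible F H') :
    IsAdmissible F (H ⊔ H') where
  spanned x := (h.spanned x).sup (h'.spanned x)
  le_stabilizer x := sup_le (h.le_stabilizer x) (h'.le_stabilizer x)
  mem y z y' z' h1 h2 := (h.mem y z y' z' h1 h2).trans (le_sup_left (a := H (orbitRep G z)))

theorem IsAdmissible.exists_le_mem {H : X → Subgroup G} (h : IsAdmissible F H) {v : X} {k : G}
    (hk : k ∈ MulAction.stabilizer G v) :
    ∃ H', IsAdmissible F H' ∧ H ≤ H' ∧ k ∈ H' v := by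
  let D : X → Set G := fun x => {k' | k' = k ∧ x = v}
  refine ⟨fun x => H x ⊔ Subgroup.closure (D x), ⟨fun x => ?_, fun x => ?_, ?_⟩,
    fun x => le_sup_left, Subgroup.mem_sup_right (Subgroup.subset_closure ⟨rfl, rfl⟩)⟩
  · exact (h.spanned x).sup (CompactlySpanned.of_isCompact
      ((Set.finite_singleton k).subset fun _ h => h.1).isCompact).closure
  · refine sup_le (h.le_stabilizer x) ((Subgroup.closure_le _).2 ?_)
    rintro _ ⟨rfl, rfl⟩
    exact hk
  · intro y z y' z' h1 h2
    exact (h.mem y z y' z' h1 h2).trans (le_sup_left (a := H (orbitRep G z)))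

/-- Two vertices in one fibre differ by an element of a vertex stabilizer; adjoining it to `H`
identifies them. -/
theorem IsAdmissible.exists_cosetVertex_eq {H : X → Subgroup G} (h : IsAdmissible F H)
    {g g' : G} {x y : X} (hxy : g • x = g' • y) :
    ∃ H', IsAdmissible F H' ∧ H ≤ H' ∧ cosetVertex H' g x = cosetVertex H' g' y := by
  obtain ⟨H', h1, h2, h3⟩ := h.exists_le_mem (v := orbitRep G x)
    (k := (g * transporter G x)⁻¹ * (g' * transporter G y)) (by
      rw [MulAction.mem_stabilizer_iff, mul_smul, inv_smul_eq_iff, orbitRep_eq hxy, mul_smul,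
        transporter_smul, ← orbitRep_eq hxy, mul_smul, transporter_smul, hxy])
  exact ⟨H', h1, h2, (cosetVertex_eq_iff H' hxy).2 h3⟩

/-- If two edges at `a` have the same image in `T`, then `g⁻¹ * g'` carries one of the underlying
edges of `F` to the other, so their ends differ by an element of `edgeTransporters`. -/
theorem IsAdmissible.locally_injective {H : X → Subgroup G} (h : IsAdmissible F H)
    (a b c : X × Set G) (hab : (cosetGraph F H).Adj a b) (hac : (cosetGraph F H).Adj a c)
    (hbc : b.1 = c.1) : b = c := by
  obtain ⟨g, y, z, hF, rfl, rfl⟩ := hab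
  obtain ⟨g', y', z', hF', ha, rfl⟩ := hac
  have hy : g • y = g' • y' := congrArg Prod.fst ha
  rw [cosetVertex_eq_iff H hbc]
  refine h.mem y z y' z' hF hF' ⟨g⁻¹ * g', ?_, ?_, by group⟩
  · rw [mul_smul, inv_smul_eq_iff]; exact hy.symm
  · rw [mul_smul, inv_smul_eq_iff]; exact hbc.symm

/-- The projection of the graph of cosets to `T`. -/
def cosetGraphHom (hT : ActsOnGraph G T) (F : T.Subgraph) (H : X → Subgroup G) :
    cosetGraph F H →g T where
  toFun := Prod.fst
  map_rel' := by
    rintro _ _ ⟨g, y, z, h, rfl, rfl⟩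
    exact hT g y z h.adj_sub

/-- A path in `T` is lifted edge by edge. Successive lifts need not meet, but they do so after
enlarging `H`. -/
theorem IsAdmissible.exists_reachable {H : X → Subgroup G} (h : IsAdmissible F H)
    (hcov : ∀ x y : X, T.Adj x y → ∃ (g : G) (x' y' : X), F.Adj x' y' ∧ g • x' = x ∧ g • y' = y)
    (x w : X) (hw : Relation.ReflTransGen T.Adj x w) :
    ∀ (g : G) (y : X), g • y = w → ∃ H', IsAdmissible F H' ∧ H ≤ H' ∧
      (cosetGraph F H').Reachable (cosetVertex H' 1 x) (cosetVertex H' g y) := by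
  induction hw with
  | refl =>
    intro g y hy
    obtain ⟨H', h1, h2, h3⟩ := h.exists_cosetVertex_eq (g := 1) (x := x) (g' := g) (y := y)
      (by rw [one_smul, hy])
    exact ⟨H', h1, h2, h3 ▸ SimpleGraph.Reachable.refl _⟩
  | tail _ hadj ih =>
    intro g y hy
    obtain ⟨k, x', y', hF, hx', hy'⟩ := hcov _ _ hadj
    obtain ⟨H₁, h1, h2, h3⟩ := ih k x' hx'
    obtain ⟨H₂, h4, h5, h6⟩ := h1.exists_cosetVertex_eq (g := k) (x := y') (g' := g) (y := y)
      (by rw [hy, hy'])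
    refine ⟨H₂, h4, h2.trans h5, (reachable_mono F h5 h3).trans ?_⟩
    rw [← h6]
    exact SimpleGraph.Adj.reachable ⟨k, x', y', hF, rfl, rfl⟩

theorem IsAdmissible.map_edgeStabilizer_le {H : X → Subgroup G} (h : IsAdmissible F H) {y z : X}
    (hF : F.Adj y z) {s : G} (hs : s ∈ edgeStabilizer G y z) :
    (transporter G z)⁻¹ * s * transporter G z ∈ H (orbitRep G z) := by
  obtain ⟨h1, h2⟩ := Subgroup.mem_inf.1 hs
  exact h.mem y z y z hF hF ⟨s, h1, h2, rfl⟩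

/-- The open stabilizer of an edge of `F` at `z` fixes the vertex above `z`, by admissibility. -/
theorem IsAdmissible.isOpen_componentStabilizer [IsTopologicalGroup G] {H : X → Subgroup G}
    (h : IsAdmissible F H) (hd : ActsDiscretely G T) {y z : X} (hF : F.Adj y z) :
    IsOpen (componentStabilizer F H z : Set G) := by
  refine Subgroup.isOpen_mono (H₁ := edgeStabilizer G y z) (fun s hs => ?_) (hd.2 y z hF.adj_sub)
  have hz : (1 : G) • z = s • z := by
    rw [one_smul]; exact (Subgroup.mem_inf.1 hs).2.symm
  have he : cosetVertex H 1 z = cosetVertex H s z := by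
    rw [cosetVertex_eq_iff H hz, one_mul, ← mul_assoc]
    exact h.map_edgeStabilizer_le hF hs
  change (cosetGraph F H).Reachable _ _
  rw [he]

/-- A conjugate of `s` fixes `z` and preserves the component, which meets each fibre in at most one
point. So it fixes the vertex above `z`, and this means that `s` is in `H`. -/
theorem IsAdmissible.eq_stabilizer {H : X → Subgroup G} (h : IsAdmissible F H)
    (hT : ActsOnGraph G T) (hac : T.IsAcyclic) {z : X} (hz : componentStabilizer F H z = ⊤) :
    H (orbitRep G z) = MulAction.stabilizer G (orbitRep G z) := by
  refine le_antisymm (h.le_stabilizer _) fun s hs => ?_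
  have hg : transporter G z * s * (transporter G z)⁻¹ ∈ componentStabilizer F H z :=
    hz ▸ Subgroup.mem_top _
  have hfst : (1 : G) • z = (transporter G z * s * (transporter G z)⁻¹) • z := by
    rw [mul_smul, mul_smul, inv_smul_eq_iff.2 (transporter_smul G z).symm,
      MulAction.mem_stabilizer_iff.1 hs, transporter_smul, one_smul]
  have := hac.eq_of_reachable_of_locally_injective (cosetGraphHom hT F H) h.locally_injective hg
    hfst
  rw [cosetVertex_eq_iff H hfst] at this
  simpa [mul_assoc] using this

theorem compactlySpanned_stabilizer_smul [IsTopologicalGroup G] (g : G) {x : X}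
    (h : CompactlySpanned (MulAction.stabilizer G x : Set G)) :
    CompactlySpanned (MulAction.stabilizer G (g • x) : Set G) := by
  rw [MulAction.stabilizer_smul_eq_stabilizer_map_conj]
  exact h.map _ (by
    change Continuous fun x => g * x * g⁻¹
    fun_prop)

end

/-- Vertex stabilizers of a discrete, cocompact action of a compactly generated group on a tree
with compactly generated edge stabilizers are compactly generated. -/
theorem isCompactlyGeneratedGroup_stabilizer {G X : Type*} [Group G] [TopologicalSpace G]
    [IsTopologicalGroup G] [MulAction G X] {T : SimpleGraph X} (hT : T.IsTree)
    (ha : ActsOnGraph G T) (hd : ActsDiscretely G T) (hc : ActsCocompactly G T)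
    (hE : ∀ x y, T.Adj x y → IsCompactlyGeneratedGroup (edgeStabilizer G x y))
    (hG : IsCompactlyGeneratedGroup G) (x : X) :
    IsCompactlyGeneratedGroup (MulAction.stabilizer G x) := by
  apply CompactlySpanned.isCompactlyGeneratedGroup
  obtain ⟨F, hF, -, hcov⟩ := hc
  by_cases hx : ∃ w, T.Adj w x
  · obtain ⟨w, hw⟩ := hx
    obtain ⟨g, y, z, hyz, -, hz⟩ := hcov w x hw
    obtain ⟨H₀, hH₀⟩ := exists_isAdmissible F hF hE
    have : Nonempty {H : X → Subgroup G // IsAdmissible F H} := ⟨⟨H₀, hH₀⟩⟩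
    obtain ⟨⟨H, hH⟩, hP⟩ := hG.eq_top_of_directed
      (fun H : {H : X → Subgroup G // IsAdmissible F H} => componentStabilizer F H.1 z)
      (fun H => H.2.isOpen_componentStabilizer hd hyz)
      (fun H H' => ⟨⟨H.1 ⊔ H'.1, H.2.sup H'.2⟩,
        fun _ hs => reachable_mono F le_sup_left hs, fun _ hs => reachable_mono F le_sup_right hs⟩)
      (fun g => by
        obtain ⟨H, h, -, hr⟩ := hH₀.exists_reachable hcov z (g • z)
          ((SimpleGraph.reachable_iff_reflTransGen _ _).1 (hT.connected.preconnected _ _)) g z rfl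
        exact ⟨⟨H, h⟩, hr⟩)
    have hs := hH.spanned (orbitRep G z)
    rw [hH.eq_stabilizer ha hT.isAcyclic hP] at hs
    have := compactlySpanned_stabilizer_smul (g * transporter G z) hs
    rwa [mul_smul, transporter_smul, hz] at this
  -- Without an edge at `x`, the tree is the single vertex `x`.
  · have : MulAction.stabilizer G x = ⊤ := by
      refine Subgroup.ext fun g => iff_of_true ?_ (Subgroup.mem_top g)
      have hw : ∀ w, T.Walk x w → w = x := by
        rintro _ (_ | ⟨h, -⟩)
        exacts [rfl, (hx ⟨_, h.symm⟩).elim]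
      exact hw _ (hT.connected.preconnected x (g • x)).some
    rw [this]
    obtain ⟨S, hS, h⟩ := hG
    exact ⟨S, hS, by rw [h, Subgroup.closure_eq]⟩

end ActsOnGraph

/-! ### A permutation representation of the path group -/

/-- If `Y` embeds into `I`, and `I` embeds into both parts of `Y` that a predicate cuts out, then
there is an equivalence of `Bool × I` with `Y` that respects the two parts. -/
theorem exists_equiv_bool_prod {Y I : Type*} (p : Y → Prop) (f : Y ↪ I)
    (g : I ↪ {y // p y}) (g' : I ↪ {y // ¬ p y}) :
    ∃ e : Bool × I ≃ Y, ∀ ω, p (e ω) ↔ ω.1 = true := by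
  classical
  obtain ⟨u, hu⟩ := Function.Embedding.schroeder_bernstein g.injective
    (((Function.Embedding.subtype p).trans f).injective)
  obtain ⟨u', hu'⟩ := Function.Embedding.schroeder_bernstein g'.injective
    (((Function.Embedding.subtype fun y => ¬ p y).trans f).injective)
  refine ⟨(Equiv.boolProdEquivSum I).trans (((Equiv.ofBijective u' hu').sumCongr
    (Equiv.ofBijective u hu)).trans ((Equiv.sumComm _ _).trans (Equiv.sumCompl p))), ?_⟩
  rintro ⟨b, i⟩
  cases b
  · simpa [Equiv.boolProdEquivSum] using (u' i).2
  · simpa [Equiv.boolProdEquivSum] using (u i).2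

/-- Let `H` be a subgroup of `G` that contains the image of a monomorphism `η` from `E`. As an
`E`-set, `G × Bool × I` is free, and so are `H × {true} × I` and its complement. If `I` is large,
this determines them up to isomorphism. -/
theorem exists_equivariant_equiv {E G I : Type*} [Group E] [Group G] [Infinite I] (η : E →* G)
    (hη : Function.Injective η) (H : Subgroup G) (hH : η.range ≤ H) (f : G ↪ I) :
    ∃ Ψ : E × (Bool × I) ≃ G × (Bool × I),
      (∀ c' c ω, Ψ (c' * c, ω) = (η c' * (Ψ (c, ω)).1, (Ψ (c, ω)).2)) ∧
      ∀ c ω, ((Ψ (c, ω)).1 ∈ H ∧ (Ψ (c, ω)).2.1 = true) ↔ ω.1 = true := by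
  let Q := Quotient (QuotientGroup.rightRel η.range)
  let rep : Q → G := Quotient.out
  have hrep : ∀ g : G, ∃ c : E, η c * rep (Quotient.mk _ g) = g := fun g => by
    have := QuotientGroup.rightRel_apply.1 (Quotient.mk_out (s := QuotientGroup.rightRel η.range) g)
    obtain ⟨c, hc⟩ := this
    exact ⟨c, by rw [hc]; simp [rep]⟩
  have hmk : ∀ c q, (Quotient.mk (QuotientGroup.rightRel η.range) (η c * rep q)) = q := by
    intro c q
    conv_rhs => rw [← Quotient.out_eq q]
    refine Quotient.sound (QuotientGroup.rightRel_apply.2 ?_)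
    exact ⟨c⁻¹, by simp [rep]⟩
  -- A transversal of the right cosets of the image of `η` exhibits `G` as a free `E`-set.
  have hbij : Function.Bijective fun x : E × Q => η x.1 * rep x.2 := by
    refine ⟨fun ⟨c, q⟩ ⟨c', q'⟩ h => ?_, fun g => ?_⟩
    · have hq : q = q' := by rw [← hmk c q, ← hmk c' q']; exact congrArg _ h
      subst hq
      exact Prod.ext (hη (mul_right_cancel h)) rfl
    · obtain ⟨c, hc⟩ := hrep g
      exact ⟨(c, _), hc⟩
  have hrinj : Function.Injective rep := fun q q' h => by
    rw [← hmk 1 q, ← hmk 1 q', h]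
  have hmemH : ∀ c q, η c * rep q ∈ H ↔ rep q ∈ H := fun c q =>
    H.mul_mem_cancel_left (hH ⟨c, rfl⟩)
  obtain ⟨c₀, hc₀⟩ := hrep 1
  let q₀ : Q := Quotient.mk _ 1
  have hq₀ : rep q₀ ∈ H := (hmemH c₀ _).1 (hc₀ ▸ H.one_mem)
  obtain ⟨sq⟩ : Nonempty (I × I ≃ I) := Cardinal.eq.1 (by
    rw [Cardinal.mk_prod, Cardinal.lift_id, Cardinal.mul_eq_self (Cardinal.aleph0_le_mk I)])
  obtain ⟨bo⟩ : Nonempty (Bool ↪ I) := ⟨(Function.Embedding.trans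
    ⟨fun b : Bool => (b.toNat : ℕ), fun a b h => by cases a <;> cases b <;> simp_all⟩
    (Infinite.natEmbedding I))⟩
  -- The predicate depends only on the `E`-orbit. The trivial coset shows that its part is large;
  -- the factor `Bool` keeps the complement large even if `H` is all of `G`.
  obtain ⟨e, he⟩ := exists_equiv_bool_prod (I := I) (Y := Q × (Bool × I))
    (fun y => rep y.1 ∈ H ∧ y.2.1 = true)
    ((((Function.Embedding.mk rep hrinj).trans f).prodMap
      ((bo.prodMap (Function.Embedding.refl I)).trans sq.toEmbedding)).trans sq.toEmbedding)
    ⟨fun i => ⟨(q₀, true, i), hq₀, rfl⟩, fun i j h => by simpa using h⟩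
    ⟨fun i => ⟨(q₀, false, i), by simp⟩, fun i j h => by simpa using h⟩
  refine ⟨((Equiv.refl E).prodCongr e).trans ((Equiv.prodAssoc _ _ _).symm.trans
    ((Equiv.ofBijective _ hbij).prodCongr (Equiv.refl _))), ?_, ?_⟩
  · intro c' c ω
    simp [mul_assoc]
  · intro c ω
    rw [← he ω, ← hmemH c]
    rfl

namespace GraphOfTopGroups

/-- Left multiplication on the first factor. -/
def mulLeftFst (G W : Type*) [Group G] : G →* Equiv.Perm (G × W) where
  toFun x := (Equiv.mulLeft x).prodCongr (Equiv.refl W)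
  map_one' := by ext <;> simp
  map_mul' x y := by ext <;> simp [mul_assoc]

variable {V : Type u} {K : Type*} {Gv : V → Type w} {Ge : K → Type*}
  [∀ v, Group (Gv v)] [∀ v, TopologicalSpace (Gv v)]
  [∀ k, Group (Ge k)] [∀ k, TopologicalSpace (Ge k)]
  (𝒢 : GraphOfTopGroups V K Gv Ge)

/-- The permutations that preserve the first coordinate. -/
def fstStabilizer (I : Type*) : Subgroup (Equiv.Perm (Bool × I)) where
  carrier := {σ | ∀ ω, (σ ω).1 = ω.1}
  one_mem' _ := rfl
  mul_mem' {σ τ} hσ hτ ω := (hσ (τ ω)).trans (hτ ω)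
  inv_mem' {σ} hσ ω := by rw [← hσ (σ⁻¹ ω), ← Equiv.Perm.mul_apply, mul_inv_cancel, Equiv.Perm.one_apply]

/-- If the subgroups `H v` of the vertex groups contain the images of the edge groups, then there
is a homomorphism of the path group to a permutation group and a subgroup of the latter
whose preimage contains all edges and meets the vertex groups in the subgroups `H v`.
The homomorphism is faithful on vertex groups. -/
theorem exists_hom_perm (H : ∀ v, Subgroup (Gv v)) (hH : ∀ e, (𝒢.η e).range ≤ H (𝒢.term e)) :
    ∃ (I : Type (max u w)) (ρ : 𝒢.PathGroup →* Equiv.Perm (Bool × I)),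
      (∀ v, Function.Injective (ρ.comp (𝒢.vertex v))) ∧
      (∀ e, ρ (𝒢.edge e) ∈ fstStabilizer I) ∧
      ∀ v x, ρ (𝒢.vertex v x) ∈ fstStabilizer I ↔ x ∈ H v := by
  have := 𝒢.nonempty
  let I := (Σ v, Gv v) × ℕ
  have : Nonempty (Σ v, Gv v) := ⟨⟨Classical.arbitrary V, 1⟩⟩
  let f : ∀ v, Gv v ↪ I := fun v => ⟨fun x => (⟨v, x⟩, 0), fun x y h => by simpa [I] using h⟩
  have hθ : ∀ v, ∃ θ : Bool × I ≃ Gv v × (Bool × I),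
      ∀ ω, ((θ ω).1 ∈ H v ∧ (θ ω).2.1 = true) ↔ ω.1 = true := fun v => by
    -- For the trivial group, equivariance is void and a bijection matching the two halves is left.
    obtain ⟨Ψ, -, h⟩ := exists_equivariant_equiv (E := Unit) (1 : Unit →* Gv v)
      (Function.injective_of_subsingleton _) (H v) (by simp) (f v)
    exact ⟨(Equiv.punitProd _).symm.trans Ψ, fun ω => h _ ω⟩
  choose θ hθ using hθ
  choose Ψ hΨ hΨH using fun e => exists_equivariant_equiv (𝒢.η e) (𝒢.η_injective e)
    (H (𝒢.term e)) (hH e) (f (𝒢.term e))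
  let ρv : ∀ v, Gv v →* Equiv.Perm (Bool × I) := fun v =>
    ((θ v).symm.permCongrHom).toMonoidHom.comp (mulLeftFst (Gv v) (Bool × I))
  have hρv : ∀ v x ω, θ v (ρv v x ω) = (x * (θ v ω).1, (θ v ω).2) := fun v x ω => by
    simp only [ρv, mulLeftFst, Equiv.permCongrHom]
    simp
    rfl
  -- In this coordinate, the edge group acts through `η e` by left multiplication on itself.
  let α : ∀ e : K × Bool, Ge e.1 × (Bool × I) ≃ Bool × I := fun e =>
    (Ψ e).trans (θ (𝒢.term e)).symm
  have hα : ∀ e c' c ω, ρv _ (𝒢.η e c') (α e (c, ω)) = α e (c' * c, ω) := fun e c' c ω => by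
    apply (θ (𝒢.term e)).injective
    rw [hρv]
    simp [α, hΨ]
  have hαfst : ∀ e c ω, (α e (c, ω)).1 = ω.1 := fun e c ω => by
    rw [Bool.eq_iff_iff, ← hθ (𝒢.term e), ← hΨH e c ω]
    simp [α]
  -- Changing the coordinate from `α e` to `α (rev e)` intertwines both actions of the edge group,
  -- as the relators demand.
  let σ : ∀ e : K × Bool, Equiv.Perm (Bool × I) := fun e => (α e).symm.trans (α (rev e))
  have hσα : ∀ e c ω, σ e (α e (c, ω)) = α (rev e) (c, ω) := fun e c ω =>
    congrArg (α (rev e)) ((α e).symm_apply_apply _)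
  have hσrev : ∀ e, σ e * σ (rev e) = 1 := by
    rintro ⟨k, b⟩
    ext1 ω
    obtain ⟨⟨d, ω⟩, rfl⟩ := (α (rev (k, b))).surjective ω
    cases b
    · exact (congrArg (σ (k, false)) (hσα (rev (k, false)) d ω)).trans (hσα (k, false) d ω)
    · exact (congrArg (σ (k, true)) (hσα (rev (k, true)) d ω)).trans (hσα (k, true) d ω)
  have hσ : ∀ e c, σ e * ρv _ (𝒢.η e c) = ρv _ (𝒢.η (rev e) c) * σ e := by
    intro e c
    ext1 ω
    obtain ⟨⟨d, ω⟩, rfl⟩ := (α e).surjective ω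
    rw [Equiv.Perm.mul_apply, Equiv.Perm.mul_apply, hα, hσα, hσα]
    exact (hα (rev e) c d _).symm
  have hσmem : ∀ e, σ e ∈ fstStabilizer I := by
    intro e ω
    obtain ⟨⟨d, ω⟩, rfl⟩ := (α e).surjective ω
    rw [hσα, hαfst]
    exact hαfst (rev e) d _
  let ρ₀ : 𝒢.FreePathGroup →* Equiv.Perm (Bool × I) :=
    Monoid.Coprod.lift (Monoid.CoprodI.lift ρv) (FreeGroup.lift σ)
  have hv : ∀ v x, ρ₀ (𝒢.freeVertex v x) = ρv v x := fun v x => by simp [ρ₀, freeVertex]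
  have he : ∀ e, ρ₀ (𝒢.freeEdge e) = σ e := fun e => by simp [ρ₀, freeEdge]
  have hρ₀ : Subgroup.normalClosure 𝒢.relators ≤ ρ₀.ker := by
    refine Subgroup.normalClosure_le_normal ?_
    rintro _ (⟨e, rfl⟩ | ⟨e, c, rfl⟩)
    · change ρ₀ _ = 1
      rw [map_mul, he, he, hσrev]
    · change ρ₀ _ = 1
      rw [map_mul, map_mul, map_mul, map_inv, map_inv, he, hv, hv, hσ, mul_inv_cancel_right,
        mul_inv_cancel]
  let ρ : 𝒢.PathGroup →* Equiv.Perm (Bool × I) := QuotientGroup.lift _ ρ₀ hρ₀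
  have hv' : ∀ v x, ρ (𝒢.vertex v x) = ρv v x := hv
  have he' : ∀ e, ρ (𝒢.edge e) = σ e := he
  refine ⟨I, ρ, fun v => ?_, fun e => he' e ▸ hσmem e, fun v x => ?_⟩
  · rw [injective_iff_map_eq_one]
    intro x hx
    have := hρv v x ((θ v).symm (1, true, Classical.arbitrary I))
    rw [← hv', show ρ (𝒢.vertex v x) = 1 from hx] at this
    simpa using this.symm
  · rw [hv']
    constructor
    · intro h
      -- The point with coordinates `(1, true, _)` is in the true half, and `x` moves it to `(x,
      -- true, _)`, which is there only if `x ∈ H v`.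
      have h1 := hθ v ((θ v).symm (1, true, Classical.arbitrary I))
      have h2 := hθ v (ρv v x ((θ v).symm (1, true, Classical.arbitrary I)))
      rw [h, ← h1, hρv] at h2
      simpa [H v |>.one_mem] using h2
    · intro hx ω
      have h1 := hθ v (ρv v x ω)
      rw [hρv, (H v).mul_mem_cancel_left hx, hθ] at h1
      exact Bool.eq_iff_iff.2 h1.symm

end GraphOfTopGroups

/-! ### Open subgroups of the fundamental group -/

namespace GraphOfTopGroups

variable {V : Type u} {K : Type*} {Gv : V → Type w} {Ge : K → Type*}
  [∀ v, Group (Gv v)] [∀ v, TopologicalSpace (Gv v)]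
  [∀ k, Group (Ge k)] [∀ k, TopologicalSpace (Ge k)]
  (𝒢 : GraphOfTopGroups V K Gv Ge)

variable {𝒢} in
theorem edge_mul_vertex (e : K × Bool) (c : Ge e.1) :
    𝒢.edge e * 𝒢.vertex _ (𝒢.η e c) = 𝒢.vertex _ (𝒢.η (rev e) c) * 𝒢.edge e := by
  rw [← mul_inv_eq_iff_eq_mul, ← mul_inv_eq_one]
  exact (QuotientGroup.eq_one_iff _).2 (Subgroup.subset_normalClosure (Or.inr ⟨e, c, rfl⟩))

variable {𝒢} in
/-- Small elements of a vertex group can be moved along paths. -/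
theorem IsPath.eventually_conj_mem [∀ v, IsTopologicalGroup (Gv v)] {v a : V} {q : 𝒢.PathGroup}
    (hq : 𝒢.IsPath v a q) : ∀ U ∈ 𝓝 (1 : Gv a), ∀ᶠ x in 𝓝 (1 : Gv v),
      ∃ y ∈ U, 𝒢.vertex v x * q = q * 𝒢.vertex a y := by
  induction hq with
  | nil z =>
    intro U hU
    have : Filter.Tendsto (fun x => z⁻¹ * x * z) (𝓝 1) (𝓝 1) :=
      Continuous.tendsto' (by fun_prop) _ _ (by simp)
    filter_upwards [this hU] with x hx
    exact ⟨_, hx, by simp only [← map_mul]; simp [mul_assoc]⟩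
  | snoc e g z _ ih =>
    intro U hU
    have h1 : Filter.Tendsto (fun c => z⁻¹ * 𝒢.η e c * z) (𝓝 1) (𝓝 1) :=
      Continuous.tendsto' (by have := 𝒢.η_continuous e; fun_prop) _ _ (by simp)
    -- Openness of `η (rev e)` makes this a neighbourhood of 1; the defining relation moves its
    -- elements across `e`.
    have h2 : 𝒢.η (rev e) '' ((fun c : Ge e.1 => z⁻¹ * 𝒢.η e c * z) ⁻¹' U) ∈
        𝓝 (1 : Gv (𝒢.orig e)) := by
      have := (𝒢.η_isOpenMap (rev e)).image_mem_nhds (x := 1) (h1 hU)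
      rwa [map_one] at this
    filter_upwards [ih _ h2] with x ⟨_, ⟨c, hc, rfl⟩, hx⟩
    refine ⟨_, hc, ?_⟩
    have := edge_mul_vertex (𝒢 := 𝒢) e c
    calc _ = 𝒢.vertex _ x * g * 𝒢.edge e * 𝒢.vertex _ z := by group
      _ = g * (𝒢.vertex _ (𝒢.η (rev e) c) * 𝒢.edge e) * 𝒢.vertex _ z := by
        rw [hx]; simp only [mul_assoc]; rfl
      _ = _ := by rw [← this, map_mul, map_mul, map_inv]; group

/-- The canonical map from the group of the base vertex. -/
def baseHom (a : V) : Gv a →* 𝒢.FundamentalGroup a :=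
  (𝒢.vertex a).codRestrict (𝒢.loopSubgroup a) IsPath.nil

/-- A subset of the fundamental group is open if it contains, with each element, its translates by
small elements of the group of the base vertex. -/
theorem isOpen_of_forall_eventually [∀ v, IsTopologicalGroup (Gv v)] {a : V}
    {W : Set (𝒢.FundamentalGroup a)}
    (hW : ∀ g ∈ W, ∀ᶠ y in 𝓝 (1 : Gv a), g * 𝒢.baseHom a y ∈ W) : IsOpen W := by
  intro v p q hp hq
  rw [isOpen_iff_mem_nhds]
  intro x hx
  have h := hq.eventually_conj_mem _ (hW _ hx)
  have ht : Filter.Tendsto (fun x' => x⁻¹ * x') (𝓝 x) (𝓝 1) :=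
    Continuous.tendsto' (by fun_prop) _ _ (by simp)
  filter_upwards [ht.eventually h] with x' ⟨y, hy, hxy⟩
  have : loop hp hq x * 𝒢.baseHom a y = loop hp hq x' := by
    apply Subtype.ext
    change p * 𝒢.vertex v x * q * 𝒢.vertex a y = p * 𝒢.vertex v x' * q
    rw [mul_assoc (p * _), ← hxy, map_mul, map_inv]
    group
  change _ ∈ W at hy
  rwa [this] at hy

theorem isOpenMap_baseHom [∀ v, IsTopologicalGroup (Gv v)] (a : V) :
    IsOpenMap (𝒢.baseHom a) := by
  intro U hU
  refine 𝒢.isOpen_of_forall_eventually ?_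
  rintro _ ⟨u, hu, rfl⟩
  have : Filter.Tendsto (fun y => u * y) (𝓝 1) (𝓝 u) :=
    Continuous.tendsto' (by fun_prop) _ _ (by simp)
  filter_upwards [this.eventually (hU.mem_nhds hu)] with y hy
  exact ⟨_, hy, map_mul _ _ _⟩

theorem isOpen_subgroup [∀ v, IsTopologicalGroup (Gv v)] {a : V}
    (W : Subgroup (𝒢.FundamentalGroup a)) {H : Subgroup (Gv a)} (hH : IsOpen (H : Set (Gv a)))
    (hW : H ≤ W.comap (𝒢.baseHom a)) : IsOpen (W : Set (𝒢.FundamentalGroup a)) :=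
  𝒢.isOpen_of_forall_eventually fun _ hg => by
    filter_upwards [hH.mem_nhds H.one_mem] with y hy
    exact mul_mem hg (hW hy)

/-- The permutation representation is faithful on vertex groups. -/
theorem vertex_injective (v : V) : Function.Injective (𝒢.vertex v) := by
  obtain ⟨I, ρ, h, -⟩ := 𝒢.exists_hom_perm (fun _ => ⊤) (fun _ => le_top)
  exact Function.Injective.of_comp (h v)

/-- The subgroup of the path group generated by all edges and by subgroups of the vertex groups. -/
def pathSubgroup (H : ∀ v, Subgroup (Gv v)) : Subgroup 𝒢.PathGroup :=
  Subgroup.closure (Set.range 𝒢.edge ∪ ⋃ v, 𝒢.vertex v '' H v)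

theorem edge_mem_pathSubgroup (H : ∀ v, Subgroup (Gv v)) (e : K × Bool) :
    𝒢.edge e ∈ 𝒢.pathSubgroup H := Subgroup.subset_closure (Or.inl ⟨e, rfl⟩)

theorem vertex_mem_pathSubgroup {H : ∀ v, Subgroup (Gv v)} {v : V} {x : Gv v} (hx : x ∈ H v) :
    𝒢.vertex v x ∈ 𝒢.pathSubgroup H :=
  Subgroup.subset_closure (Or.inr (Set.mem_iUnion.2 ⟨v, x, hx, rfl⟩))

theorem pathSubgroup_mono {H H' : ∀ v, Subgroup (Gv v)} (h : ∀ v, H v ≤ H' v) :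
    𝒢.pathSubgroup H ≤ 𝒢.pathSubgroup H' :=
  Subgroup.closure_mono (Set.union_subset_union_right _
    (Set.iUnion_mono fun v => Set.image_mono (h v)))

/-- A product of edges alone suffices, by connectedness. -/
theorem exists_isPath_mem_pathSubgroup (H : ∀ v, Subgroup (Gv v)) (a v : V) :
    ∃ p, 𝒢.IsPath a v p ∧ p ∈ 𝒢.pathSubgroup H := by
  induction 𝒢.connected a v with
  | refl => exact ⟨1, IsPath.one a, one_mem _⟩
  | tail _ h ih =>
    obtain ⟨p, hp, hpH⟩ := ih
    obtain ⟨e, rfl, rfl⟩ := h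
    exact ⟨p * 𝒢.edge e, hp.mul (IsPath.edge e), mul_mem hpH (𝒢.edge_mem_pathSubgroup H e)⟩

/-- If all loops are in the subgroup generated by the edges and by the groups `H v`, which contain
the images of the edge groups, then the groups `H v` are the vertex groups. -/
theorem eq_top_of_loopSubgroup_le {H : ∀ v, Subgroup (Gv v)}
    (hH : ∀ e, (𝒢.η e).range ≤ H (𝒢.term e)) {a : V}
    (h : 𝒢.loopSubgroup a ≤ 𝒢.pathSubgroup H) (v : V) : H v = ⊤ := by
  obtain ⟨I, ρ, -, he, hv⟩ := 𝒢.exists_hom_perm H hH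
  have hle : 𝒢.pathSubgroup H ≤ (fstStabilizer I).comap ρ := by
    refine (Subgroup.closure_le _).2 (Set.union_subset ?_ (Set.iUnion_subset fun v => ?_))
    · rintro _ ⟨e, rfl⟩
      exact he e
    · rintro _ ⟨x, hx, rfl⟩
      exact (hv v x).2 hx
  refine top_le_iff.1 fun x _ => (hv v x).1 (hle ?_)
  -- Conjugation by `p` turns `x` into a loop at `a` without leaving the subgroup.
  obtain ⟨p, hp, hpH⟩ := 𝒢.exists_isPath_mem_pathSubgroup H a v
  have : p * 𝒢.vertex v x * p⁻¹ ∈ 𝒢.pathSubgroup H := h ((hp.mul_vertex x).mul hp.inv)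
  rwa [Subgroup.mul_mem_cancel_right _ (inv_mem hpH), Subgroup.mul_mem_cancel_left _ hpH] at this

theorem exists_term_eq [Nonempty K] (v : V) : ∃ e, 𝒢.term e = v := by
  obtain ⟨k⟩ := ‹Nonempty K›
  rcases (𝒢.connected (𝒢.term (k, true)) v).cases_tail with h | ⟨_, -, e, -, h⟩
  exacts [⟨_, h.symm⟩, ⟨e, h⟩]

/-- Compactly generated subgroups of the vertex groups that contain the images of the edge
groups. -/
structure IsAdmissible (H : ∀ v, Subgroup (Gv v)) : Prop where
  spanned : ∀ v, CompactlySpanned (H v : Set (Gv v))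
  range_le : ∀ e, (𝒢.η e).range ≤ H (𝒢.term e)

theorem exists_isAdmissible [Finite K] (hE : ∀ k, IsCompactlyGeneratedGroup (Ge k)) :
    ∃ H, 𝒢.IsAdmissible H := by
  refine ⟨fun v => Subgroup.closure (⋃ e : K × Bool,
      {x | ∃ h : 𝒢.term e = v, x ∈ h ▸ (𝒢.η e).range}),
    fun v => (CompactlySpanned.iUnion fun e => ?_).closure, fun e x hx => ?_⟩
  · by_cases h : 𝒢.term e = v
    · subst h
      convert (hE e.1).compactlySpanned_image (𝒢.η e) (𝒢.η_continuous e)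
      ext
      simp
    · simpa [h] using CompactlySpanned.of_isCompact (isCompact_empty (X := Gv v))
  · exact Subgroup.subset_closure (Set.mem_iUnion.2 ⟨e, rfl, hx⟩)

variable {𝒢}

theorem IsAdmissible.sup {H H' : ∀ v, Subgroup (Gv v)} (h : 𝒢.IsAdmissible H)
    (h' : 𝒢.IsAdmissible H') : 𝒢.IsAdmissible fun v => H v ⊔ H' v where
  spanned v := (h.spanned v).sup (h'.spanned v)
  range_le e := (h.range_le e).trans le_sup_left

theorem IsAdmissible.exists_le_mem {H : ∀ v, Subgroup (Gv v)} (h : 𝒢.IsAdmissible H) {v : V}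
    (x : Gv v) : ∃ H', 𝒢.IsAdmissible H' ∧ (∀ w, H w ≤ H' w) ∧ x ∈ H' v := by
  -- This is the singleton of `x` at `v`, and empty at all other vertices.
  let D : ∀ w, Set (Gv w) := fun w => {y | ∃ h : v = w, h ▸ x = y}
  have hD : ∀ w, (D w).Subsingleton := by
    rintro w _ ⟨h, rfl⟩ _ ⟨_, rfl⟩
    rfl
  exact ⟨fun w => H w ⊔ Subgroup.closure (D w),
    ⟨fun w => (h.spanned w).sup (CompactlySpanned.of_isCompact (hD w).isCompact).closure,
      fun e => (h.range_le e).trans le_sup_left⟩, fun w => le_sup_left,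
    Subgroup.mem_sup_right (Subgroup.subset_closure ⟨rfl, rfl⟩)⟩

/-- Only finitely many vertex elements occur along a path; they are adjoined one at a time. -/
theorem IsAdmissible.exists_mem_pathSubgroup {H : ∀ v, Subgroup (Gv v)} (h : 𝒢.IsAdmissible H)
    {v w : V} {g : 𝒢.PathGroup} (hg : 𝒢.IsPath v w g) :
    ∃ H', 𝒢.IsAdmissible H' ∧ g ∈ 𝒢.pathSubgroup H' := by
  induction hg with
  | nil x =>
    obtain ⟨H', h1, -, h2⟩ := h.exists_le_mem x
    exact ⟨H', h1, 𝒢.vertex_mem_pathSubgroup h2⟩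
  | snoc e g x _ ih =>
    obtain ⟨H₁, h1, hg⟩ := ih
    obtain ⟨H₂, h2, h3, h4⟩ := h1.exists_le_mem x
    exact ⟨H₂, h2, mul_mem (mul_mem (𝒢.pathSubgroup_mono h3 hg) (𝒢.edge_mem_pathSubgroup _ e))
      (𝒢.vertex_mem_pathSubgroup h4)⟩

/-- Once there is an edge, each vertex is the end of one, so `H v` contains the open image of an
edge group. -/
theorem IsAdmissible.isOpen [Nonempty K] [∀ v, IsTopologicalGroup (Gv v)]
    {H : ∀ v, Subgroup (Gv v)} (h : 𝒢.IsAdmissible H) (v : V) : IsOpen (H v : Set (Gv v)) := by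
  obtain ⟨e, rfl⟩ := 𝒢.exists_term_eq v
  exact Subgroup.isOpen_mono (h.range_le e) (by
    rw [MonoidHom.coe_range]
    exact (𝒢.η_isOpenMap e).isOpen_range)

variable (𝒢)

/-- Without edges, admissible subgroups need not be open. But then there is a single vertex, and its
group is the fundamental group. -/
theorem isCompactlyGeneratedGroup_vertex_of_isEmpty [IsEmpty K] [∀ v, IsTopologicalGroup (Gv v)]
    (a : V) (h : IsCompactlyGeneratedGroup (𝒢.FundamentalGroup a)) (v : V) :
    IsCompactlyGeneratedGroup (Gv v) := by
  obtain rfl : v = a := by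
    rcases (𝒢.connected a v).cases_tail with h | ⟨_, -, e, -⟩
    exacts [h, isEmptyElim e.1]
  have hbij : Function.Bijective (𝒢.baseHom v) := by
    refine ⟨fun x y hxy => 𝒢.vertex_injective v (congrArg Subtype.val hxy), ?_⟩
    have : ∀ w g, 𝒢.IsPath v w g → ∀ h : w = v, ∃ x, 𝒢.vertex v x = g := by
      rintro _ _ (x | ⟨e, _, _, -⟩) -
      exacts [⟨x, rfl⟩, isEmptyElim e.1]
    rintro ⟨g, hg⟩
    obtain ⟨x, rfl⟩ := this v g hg rfl
    exact ⟨x, rfl⟩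
  let φ := MulEquiv.ofBijective (𝒢.baseHom v) hbij
  obtain ⟨S, hS, h⟩ := h
  have hc : Continuous φ.symm :=
    (φ.toEquiv.continuous_symm_iff).2 (𝒢.isOpenMap_baseHom v)
  refine ⟨φ.symm '' S, hS.image hc, ?_⟩
  have := congrArg (Subgroup.map φ.symm.toMonoidHom) h
  rw [MonoidHom.map_closure] at this
  exact this.trans (Subgroup.map_top_of_surjective _ φ.symm.surjective)

/-- If the fundamental group of a finite graph of topological groups with compactly generated
edge groups is compactly generated, then so are the vertex groups. -/
theorem isCompactlyGeneratedGroup_vertex [Finite K] [∀ v, IsTopologicalGroup (Gv v)] (a : V)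
    (hE : ∀ k, IsCompactlyGeneratedGroup (Ge k))
    (h : IsCompactlyGeneratedGroup (𝒢.FundamentalGroup a)) (v : V) :
    IsCompactlyGeneratedGroup (Gv v) := by
  cases isEmpty_or_nonempty K
  · exact 𝒢.isCompactlyGeneratedGroup_vertex_of_isEmpty a h v
  obtain ⟨H₀, hH₀⟩ := 𝒢.exists_isAdmissible hE
  have : Nonempty {H // 𝒢.IsAdmissible H} := ⟨⟨H₀, hH₀⟩⟩
  let P : {H // 𝒢.IsAdmissible H} → Subgroup (𝒢.FundamentalGroup a) := fun H =>
    (𝒢.pathSubgroup H.1).comap (𝒢.loopSubgroup a).subtype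
  obtain ⟨⟨H, hH⟩, hP⟩ := h.eq_top_of_directed P
    (fun H => 𝒢.isOpen_subgroup (P H) (H.2.isOpen a) fun _ hx => 𝒢.vertex_mem_pathSubgroup hx)
    (fun H H' => ⟨⟨_, H.2.sup H'.2⟩, fun _ hg => 𝒢.pathSubgroup_mono (fun _ => le_sup_left) hg,
      fun _ hg => 𝒢.pathSubgroup_mono (fun _ => le_sup_right) hg⟩)
    (fun g => by
      obtain ⟨H, hH, hg⟩ := hH₀.exists_mem_pathSubgroup g.2
      exact ⟨⟨H, hH⟩, hg⟩)
  have hle : 𝒢.loopSubgroup a ≤ 𝒢.pathSubgroup H := fun g hg => by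
    have : (⟨g, hg⟩ : 𝒢.FundamentalGroup a) ∈ P ⟨H, hH⟩ := hP ▸ Subgroup.mem_top _
    exact this
  obtain ⟨S, hS, hSH⟩ := hH.spanned v
  exact ⟨S, hS, by rw [hSH, Subgroup.closure_eq, 𝒢.eq_top_of_loopSubgroup_le hH.range_le hle]⟩

end GraphOfTopGroups

theorem mainTheorem12 :
    (∀ {V K : Type*} [Finite V] [Finite K] {Gv : V → Type*} {Ge : K → Type*}
      [∀ v, Group (Gv v)] [∀ v, TopologicalSpace (Gv v)] [∀ v, IsTopologicalGroup (Gv v)]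
      [∀ k, Group (Ge k)] [∀ k, TopologicalSpace (Ge k)] [∀ k, IsTopologicalGroup (Ge k)]
      (𝒢 : GraphOfTopGroups V K Gv Ge) (a : V),
      (∀ k, IsCompactlyGeneratedGroup (Ge k)) →
      IsCompactlyGeneratedGroup (𝒢.FundamentalGroup a) →
      ∀ v, IsCompactlyGeneratedGroup (Gv v)) ∧
    (∀ {G : Type*} [Group G] [TopologicalSpace G] [IsTopologicalGroup G]
      {X : Type*} [MulAction G X] (T : SimpleGraph X), T.IsTree →
      ActsOnGraph G T → ActsDiscretely G T → ActsCocompactly G T → ActsWithoutInversions G T →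
      (∀ x y, T.Adj x y → IsCompactlyGeneratedGroup (edgeStabilizer G x y)) →
      IsCompactlyGeneratedGroup G →
      ∀ x : X, IsCompactlyGeneratedGroup (MulAction.stabilizer G x)) :=
  ⟨fun 𝒢 a hE hG v => 𝒢.isCompactlyGeneratedGroup_vertex a hE hG v,
    fun _ hT ha hd hc _ hE hG x =>
      ActsOnGraph.isCompactlyGeneratedGroup_stabilizer hT ha hd hc hE hG x⟩
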